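/- Let $\mathcal H=\ell^2(\mathbb N)$ be a bosonic mode with Fock basis $|0\rangle,|1\rangle,\dots$. For $\lambda\in[0,1]$ let $U_\lambda=\exp[\arccos(\sqrt\lambda)\,(a^\dagger b-ab^\dagger)]$ be the beam-splitter unitary on a signal mode $S$ (annihilation operator $a$) and an environment mode $E$ (annihilation operator $b$), and let $\mathcal E_\lambda(\rho)=\mathrm{Tr}_E[U_\lambda(\rho\otimes|0\rangle\langle0|_E)U_\lambda^\dagger]$ be the pure-loss channel. Let $p_1,\dots,p_d\ge0$ with $\sum_n p_n=1$ and $\lambda_1,\dots,\lambda_d\in[0,1]$, and write $\langle f(\lambda)\rangle=\sum_n p_nf(\lambda_n)$. The fading channel is $\Phi=\sum_{n=1}^d p_n\mathcal E_{\lambda_n}$, and its complementary channel is $$\tilde\Phi(\rho)=\mathrm{Tr}_S\big[V(\rho\otimes|0\rangle\langle0|_E\otimes|\psi_p\rangle\langle\psi_p|_A)V^\dagger\big],\qquad V=\sum_n U_{\lambda_n}\otimes|n\rangle\langle n|_A,\quad |\psi_p\rangle=\sum_n\sqrt{p_n}\,|n\rangle_A .$$ $\Phi$ is antidegradable if $\Phi=\mathcal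 A\circ\tilde\Phi$ for some completely positive trace-preserving map $\mathcal A$ from the trace-class operators on $E\otimes A$ to those on $S$. Let $F(\rho,\sigma)=(\mathrm{Tr}\sqrt{\sqrt\rho\,\sigma\sqrt\rho})^2$. 1. For all such $p,\lambda$: $F(\Phi(|0\rangle\langle0|),\Phi(|1\rangle\langle1|))=1-\langle\lambda\rangle$ and $F(\tilde\Phi(|0\rangle\langle0|),\tilde\Phi(|1\rangle\langle1|))=\langle\sqrt\lambda\rangle^2$. 2. If $\langle\sqrt\lambda\rangle^2+\langle\lambda\rangle>1$, then $\Phi$ is not antidegradable. 3. For the erasure case $\Phi=p\,\mathcal E_1+(1-p)\,\mathcal E_0$ with $p\in[0,1]$, the condition $\langle\sqrt\lambda\rangle^2+\langle\lambda\rangle>1$ holds if and only if $p>(\sqrt5-1)/2$; hence $\Phi$ is not antidegradable whenever $p>(\sqrt5-1)/2$. -/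

import Mathlib

/-!
Bosonic fading channels.  A Hilbert space with a distinguished countable orthonormal basis labelled
by `ι` is modelled as `ℓ²(ι)`; the Hilbert space tensor product of `ℓ²(ι)` and `ℓ²(κ)` is `ℓ²(ι × κ)`,
with `|i⟩ ⊗ |k⟩ = |(i, k)⟩`.  A single bosonic mode is `ℓ²(ℕ)` with its Fock basis.
-/

namespace FadingChannel

noncomputable section

open scoped InnerProductSpace

/-- The Hilbert space `ℓ²(ι)`. -/
def L2 (ι : Type*) : Type _ := lp (fun _ : ι => ℂ) 2

instance (ι : Type*) : NormedAddCommGroup (L2 ι) :=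
  inferInstanceAs (NormedAddCommGroup (lp (fun _ : ι => ℂ) 2))

instance (ι : Type*) : InnerProductSpace ℂ (L2 ι) :=
  inferInstanceAs (InnerProductSpace ℂ (lp (fun _ : ι => ℂ) 2))

instance (ι : Type*) : CompleteSpace (L2 ι) :=
  inferInstanceAs (CompleteSpace (lp (fun _ : ι => ℂ) 2))

/-- Bounded operators from `ℓ²(ι)` to `ℓ²(κ)`. -/
abbrev Op (ι κ : Type*) : Type _ := L2 ι →L[ℂ] L2 κ

section Basis

variable {ι κ : Type*}

open Classical in
/-- The basis vector `|i⟩`. -/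
def ket (i : ι) : L2 ι := lp.single 2 i (1 : ℂ)

lemma orthonormal_ket : Orthonormal ℂ (ket : ι → L2 ι) := by
  classical
  rw [orthonormal_iff_ite]
  intro i j
  have h := lp.inner_single_left (𝕜 := ℂ) (G := fun _ : ι => ℂ) i (1 : ℂ) (lp.single 2 j (1 : ℂ))
  change inner ℂ (lp.single 2 i (1 : ℂ) : lp (fun _ : ι => ℂ) 2) (lp.single 2 j (1 : ℂ)) = _
  rw [h]
  by_cases hij : i = j
  · subst hij; simp
  · simp [hij]

lemma inner_ket_ket (i j : ι) [Decidable (i = j)] :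
    ⟪(ket i : L2 ι), ket j⟫_ℂ = if i = j then 1 else 0 := by
  classical
  rw [orthonormal_iff_ite.1 orthonormal_ket i j]
  congr

lemma hasSum_norm_sq (x : L2 ι) : HasSum (fun i => ‖⟪ket i, x⟫_ℂ‖ ^ 2) (‖x‖ ^ 2) := by
  classical
  have h := lp.hasSum_norm (p := 2) (E := fun _ : ι => ℂ) (by norm_num) x
  have hx : ∀ i, ⟪ket i, x⟫_ℂ = (show lp (fun _ : ι => ℂ) 2 from x) i := by
    intro i
    have h := lp.inner_single_left (𝕜 := ℂ) (G := fun _ : ι => ℂ) i (1 : ℂ) x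
    refine Eq.trans h ?_
    simp
  simp only [hx]
  norm_num at h
  exact h

/-- The isometry `|i⟩ ↦ v i` determined by an orthonormal family `v`. -/
def isometryOf {v : ι → L2 κ} (hv : Orthonormal ℂ v) : Op ι κ :=
  (show L2 ι →ₗᵢ[ℂ] L2 κ from hv.orthogonalFamily.linearIsometry).toContinuousLinearMap

lemma isometryOf_ket {v : ι → L2 κ} (hv : Orthonormal ℂ v) (i : ι) :
    isometryOf hv (ket i) = v i := by
  classical
  have h := hv.orthogonalFamily.linearIsometry_apply_single (i := i) (1 : ℂ)
  refine Eq.trans h ?_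
  simp

/-- The isometry `|i⟩ ↦ |f i⟩` determined by an injective relabelling `f` of basis vectors. -/
def embed (f : ι ↪ κ) : Op ι κ :=
  isometryOf (orthonormal_ket.comp f f.injective)

lemma embed_ket (f : ι ↪ κ) (i : ι) : embed f (ket i) = ket (f i) :=
  isometryOf_ket _ i

end Basis

section TraceClass

variable {ι κ : Type*}

/-- The trace `∑ i, ⟨i|T|i⟩`. -/
def trace (T : Op ι ι) : ℂ := ∑' i, ⟪ket i, T (ket i)⟫_ℂ

/-- A positive operator with finite trace. -/
def IsPosTrace (T : Op ι ι) : Prop :=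
  T.IsPositive ∧ Summable fun i => ⟪ket i, T (ket i)⟫_ℂ

variable (ι) in
/-- The trace-class operators on `ℓ²(ι)`: linear combinations of positive operators with finite
trace. -/
def traceClass : Submodule ℂ (Op ι ι) := Submodule.span ℂ {T | IsPosTrace T}

/-- Parseval for the Hilbert-Schmidt norm. -/
lemma summable_adjoint (A : Op ι κ) (h : Summable fun k => ‖A.adjoint (ket k)‖ ^ 2) :
    Summable fun i => ‖A (ket i)‖ ^ 2 := by
  have hent : ∀ i k, ‖⟪ket i, A.adjoint (ket k)⟫_ℂ‖ = ‖⟪ket k, A (ket i)⟫_ℂ‖ := by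
    intro i k
    rw [ContinuousLinearMap.adjoint_inner_right, norm_inner_symm]
  have h1 : Summable fun q : κ × ι => ‖⟪ket q.2, A.adjoint (ket q.1)⟫_ℂ‖ ^ 2 := by
    have hnn : ∀ q : κ × ι, 0 ≤ ‖⟪ket q.2, A.adjoint (ket q.1)⟫_ℂ‖ ^ 2 := fun _ => sq_nonneg _
    refine (summable_prod_of_nonneg hnn).2
      ⟨fun k => (hasSum_norm_sq (A.adjoint (ket k))).summable, ?_⟩
    refine h.congr fun k => ?_
    exact (hasSum_norm_sq (A.adjoint (ket k))).tsum_eq.symm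
  have h1' : Summable fun q : ι × κ => ‖⟪ket q.swap.2, A.adjoint (ket q.swap.1)⟫_ℂ‖ ^ 2 :=
    (Equiv.prodComm ι κ).summable_iff.2 h1
  have h2 := h1'.prod
  refine h2.congr fun i => ?_
  simp only [Prod.fst_swap, Prod.snd_swap, hent]
  exact (hasSum_norm_sq (A (ket i))).tsum_eq

/-- The operator norm is bounded by the Hilbert-Schmidt norm. -/
lemma norm_sq_le_tsum (A : Op ι κ) (h : Summable fun i => ‖A (ket i)‖ ^ 2) :
    ‖A‖ ^ 2 ≤ ∑' i, ‖A (ket i)‖ ^ 2 := by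
  set S := ∑' i, ‖A (ket i)‖ ^ 2 with hS
  have hS0 : 0 ≤ S := tsum_nonneg fun _ => by positivity
  have hA : A.adjoint.adjoint = A := ContinuousLinearMap.adjoint_adjoint A
  have h' : Summable fun k => ‖A.adjoint (ket k)‖ ^ 2 :=
    summable_adjoint A.adjoint (by simpa [hA] using h)
  have hbound : ∀ y, ‖A.adjoint y‖ ≤ √S * ‖y‖ := by
    intro y
    refine abs_le_of_sq_le_sq' ?_ (by positivity) |>.2
    rw [mul_pow, Real.sq_sqrt hS0, ← (hasSum_norm_sq (A.adjoint y)).tsum_eq, hS, ← tsum_mul_right]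
    refine Summable.tsum_le_tsum (fun i => ?_) (hasSum_norm_sq _).summable (h.mul_right _)
    rw [ContinuousLinearMap.adjoint_inner_right, ← mul_pow]
    gcongr
    exact norm_inner_le_norm _ _
  have hle : ‖A.adjoint‖ ≤ √S := A.adjoint.opNorm_le_bound (by positivity) hbound
  rw [LinearIsometryEquiv.norm_map] at hle
  calc ‖A‖ ^ 2 ≤ √S ^ 2 := by gcongr
    _ = S := Real.sq_sqrt hS0

/-- A positive operator is `R† R`, so its quadratic form is `‖R x‖²`. -/
lemma exists_root {T : Op ι ι} (hT : T.IsPositive) :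
    ∃ R : Op ι ι, R.adjoint = R ∧ R ∘L R = T := by
  have h0 : 0 ≤ T := (ContinuousLinearMap.nonneg_iff_isPositive T).2 hT
  exact ⟨CFC.sqrt T, (CFC.sqrt_nonneg T).isSelfAdjoint.star_eq, CFC.sqrt_mul_sqrt_self T h0⟩

lemma inner_root {R T : Op ι ι} (hR : R.adjoint = R) (hT : R ∘L R = T) (x : L2 ι) :
    ⟪x, T x⟫_ℂ = ((‖R x‖ ^ 2 : ℝ) : ℂ) := by
  rw [← hT, ContinuousLinearMap.comp_apply]
  conv_lhs => rw [← hR]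
  rw [ContinuousLinearMap.adjoint_inner_right, hR, inner_self_eq_norm_sq_to_K]
  norm_cast

lemma IsPosTrace.conj {T : Op ι ι} (hT : IsPosTrace T) (W : Op ι κ) :
    IsPosTrace (W ∘L T ∘L W.adjoint) := by
  refine ⟨hT.1.conj_adjoint W, ?_⟩
  obtain ⟨R, hR, hRT⟩ := exists_root hT.1
  have h1 : Summable fun i => ‖R (ket i)‖ ^ 2 := by
    have := hT.2
    simp only [inner_root hR hRT] at this
    exact_mod_cast this
  have h2 : Summable fun i => ‖(W ∘L R) (ket i)‖ ^ 2 := by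
    refine Summable.of_nonneg_of_le (fun _ => by positivity) (fun i => ?_) (h1.mul_left (‖W‖ ^ 2))
    rw [← mul_pow]
    gcongr
    exact W.le_opNorm _
  have h3 : Summable fun k => ‖(R ∘L W.adjoint) (ket k)‖ ^ 2 := by
    apply summable_adjoint
    simpa [ContinuousLinearMap.adjoint_comp, hR] using h2
  have : ∀ k, ⟪ket k, (W ∘L T ∘L W.adjoint) (ket k)⟫_ℂ
      = ((‖(R ∘L W.adjoint) (ket k)‖ ^ 2 : ℝ) : ℂ) := by
    intro k
    rw [ContinuousLinearMap.comp_apply, ContinuousLinearMap.comp_apply,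
      ← ContinuousLinearMap.adjoint_inner_left, inner_root hR hRT]
    rfl
  simp only [this]
  exact_mod_cast h3

/-- Conjugation `T ↦ W T W†` on bounded operators. -/
def conjOp (W : Op ι κ) : Op ι ι →ₗ[ℂ] Op κ κ where
  toFun T := W ∘L T ∘L W.adjoint
  map_add' S T := by ext1 x; simp
  map_smul' c T := by ext1 x; simp

/-- Conjugation `T ↦ W T W†` on trace-class operators. -/
def conj (W : Op ι κ) : traceClass ι →ₗ[ℂ] traceClass κ :=
  (conjOp W).restrict (p := traceClass ι) (q := traceClass κ) (by
    intro T hT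
    have : traceClass ι ≤ (traceClass κ).comap (conjOp W) :=
      Submodule.span_le.2 fun T hT => Submodule.subset_span (IsPosTrace.conj hT W)
    exact this hT)

/-- The isometry `1 ⊗ |k⟩`. -/
def tensorKet (k : κ) : Op ι (ι × κ) :=
  embed ⟨fun i => (i, k), fun _ _ h => (Prod.ext_iff.1 h).1⟩

/-- The block `(1 ⊗ ⟨k|) T (1 ⊗ |k⟩)`. -/
def block (k : κ) (T : Op (ι × κ) (ι × κ)) : Op ι ι :=
  (tensorKet k).adjoint ∘L T ∘L tensorKet k

lemma inner_block (k : κ) (T : Op (ι × κ) (ι × κ)) (i : ι) :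
    ⟪ket i, block k T (ket i)⟫_ℂ = ⟪ket (i, k), T (ket (i, k))⟫_ℂ := by
  have h : tensorKet k (ket i) = (ket (i, k) : L2 (ι × κ)) := embed_ket _ _
  rw [block, ContinuousLinearMap.comp_apply, ContinuousLinearMap.adjoint_inner_right,
    ContinuousLinearMap.comp_apply, h]

lemma summable_block_of_pos {T : Op (ι × κ) (ι × κ)} (hT : IsPosTrace T) :
    Summable fun k => block k T := by
  obtain ⟨R, hR, hRT⟩ := exists_root hT.1
  have hsum : Summable fun q : ι × κ => ‖R (ket q)‖ ^ 2 := by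
    have := hT.2
    simp only [inner_root hR hRT] at this
    exact_mod_cast this
  have hket : ∀ (k : κ) (i : ι), tensorKet k (ket i) = (ket (i, k) : L2 (ι × κ)) :=
    fun k i => embed_ket _ _
  have hsw : Summable fun q : κ × ι => ‖R (ket q.swap)‖ ^ 2 :=
    (Equiv.prodComm κ ι).summable_iff.2 hsum
  refine Summable.of_norm_bounded (g := fun k => ∑' i, ‖R (ket (i, k))‖ ^ 2) hsw.prod fun k => ?_
  have hb : block k T = (R ∘L tensorKet k).adjoint ∘L (R ∘L tensorKet k) := by
    rw [ContinuousLinearMap.adjoint_comp, hR, block, ← hRT]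
    rfl
  rw [hb, ContinuousLinearMap.norm_adjoint_comp_self, ← sq]
  have := norm_sq_le_tsum (R ∘L (tensorKet k : Op ι (ι × κ)))
    (by simpa [hket] using hsw.prod_factor k)
  simpa [hket] using this

lemma summable_block {T : Op (ι × κ) (ι × κ)} (hT : T ∈ traceClass (ι × κ)) :
    Summable fun k => block k T := by
  induction hT using Submodule.span_induction with
  | mem T hT => exact summable_block_of_pos hT
  | zero => simp [block]
  | add S T _ _ hS hT => simpa [block] using hS.add hT
  | smul c T _ hT => simpa [block] using hT.const_smul c

lemma IsPosTrace.tsum_block {T : Op (ι × κ) (ι × κ)} (hT : IsPosTrace T) :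
    IsPosTrace (∑' k, block k T) := by
  have hs := summable_block_of_pos hT
  refine ⟨?_, ?_⟩
  · rw [← ContinuousLinearMap.nonneg_iff_isPositive]
    refine tsum_nonneg fun k => ?_
    rw [ContinuousLinearMap.nonneg_iff_isPositive]
    exact hT.1.adjoint_conj _
  · refine hT.2.prod.congr fun i => ?_
    have h0 : HasSum (fun k => block k T (ket i)) ((∑' k, block k T) (ket i)) :=
      hs.hasSum.mapL (ContinuousLinearMap.apply ℂ (L2 ι) (ket i : L2 ι))
    have h1 : HasSum (fun k => ⟪ket i, block k T (ket i)⟫_ℂ)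
        ⟪ket i, (∑' k, block k T) (ket i)⟫_ℂ :=
      h0.mapL (innerSL ℂ (ket i : L2 ι))
    simp only [inner_block] at h1
    exact h1.tsum_eq

/-- The partial trace over the second factor, `T ↦ ∑ k, (1 ⊗ ⟨k|) T (1 ⊗ |k⟩)` (the series converges
absolutely in operator norm). -/
def partialTraceRight : traceClass (ι × κ) →ₗ[ℂ] traceClass ι where
  toFun T := ⟨∑' k, block k (T : Op (ι × κ) (ι × κ)), by
    obtain ⟨T, hT⟩ := T
    change (∑' k, block k T) ∈ _
    induction hT using Submodule.span_induction with
    | mem T hT => exact Submodule.subset_span hT.tsum_block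
    | zero => simp [block]
    | add S T hS hT ihS ihT =>
      have h : ∀ k, block k (S + T) = block k S + block k T := fun k => by simp [block]
      simp only [h]
      rw [(summable_block hS).tsum_add (summable_block hT)]
      exact add_mem ihS ihT
    | smul c T hT ih =>
      have h : ∀ k, block k (c • T) = c • block k T := fun k => by simp [block]
      simp only [h]
      rw [(summable_block hT).tsum_const_smul]
      exact Submodule.smul_mem _ _ ih⟩
  map_add' S T := by
    ext1
    have h : ∀ k, block k ((S + T : traceClass (ι × κ)) : Op (ι × κ) (ι × κ))
        = block k S + block k T := fun k => by simp [block]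
    exact (tsum_congr h).trans ((summable_block S.2).tsum_add (summable_block T.2))
  map_smul' c T := by
    ext1
    have h : ∀ k, block k ((c • T : traceClass (ι × κ)) : Op (ι × κ) (ι × κ))
        = c • block k T := fun k => by simp [block]
    exact (tsum_congr h).trans ((summable_block T.2).tsum_const_smul c)

/-- The partial trace over the first factor. -/
def partialTraceLeft : traceClass (κ × ι) →ₗ[ℂ] traceClass ι :=
  partialTraceRight ∘ₗ conj (embed (Equiv.prodComm κ ι).toEmbedding)

end TraceClass

section Channels

variable {ι κ : Type*}

open ComplexOrder in
/-- Positivity of the operator matrix `M`, as an operator on `ℓ²(ι) ⊗ ℂⁿ`. -/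
def BlockPositive {n : ℕ} (M : Fin n → Fin n → traceClass ι) : Prop :=
  ∀ x : Fin n → L2 ι, 0 ≤ ∑ a, ∑ b, ⟪x a, (M a b : Op ι ι) (x b)⟫_ℂ

/-- Quantum channels: completely positive trace-preserving linear maps between spaces of
trace-class operators. -/
structure IsQuantumChannel (A : traceClass ι →ₗ[ℂ] traceClass κ) : Prop where
  completelyPositive : ∀ (n : ℕ) (M : Fin n → Fin n → traceClass ι),
    BlockPositive M → BlockPositive fun a b => A (M a b)
  tracePreserving : ∀ T : traceClass ι, trace (A T : Op κ κ) = trace (T : Op ι ι)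

/-- The squared Uhlmann fidelity `F(ρ, σ) = (Tr √(√ρ σ √ρ))²`. -/
def fidelity (ρ σ : traceClass ι) : ℝ :=
  (trace (CFC.sqrt (CFC.sqrt (ρ : Op ι ι) * (σ : Op ι ι) * CFC.sqrt (ρ : Op ι ι)))).re ^ 2

/-- The pure state `|i⟩⟨i|`. -/
def pureKet (i : ι) : traceClass ι :=
  ⟨InnerProductSpace.rankOne ℂ (ket i) (ket i), by
    refine Submodule.subset_span ⟨?_, ?_⟩
    · exact InnerProductSpace.isPositive_rankOne_self _
    · refine summable_of_ne_finset_zero (s := {i}) fun j hj => ?_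
      have hj' : i ≠ j := fun h => hj (by simp [h])
      classical simp [inner_ket_ket, hj']⟩

end Channels

section BeamSplitter

/-- Matrix elements `⟨m'|a|m⟩` of the annihilation operator in the Fock basis. -/
def annihilation (m' m : ℕ) : ℂ := if m = m' + 1 then (√(m : ℝ) : ℂ) else 0

/-- Matrix elements `⟨m'|a†|m⟩` of the creation operator in the Fock basis. -/
def creation (m' m : ℕ) : ℂ := star (annihilation m m')

/-- The restriction of `a†b − ab†` to the span of the two-mode Fock vectors `|m⟩|n⟩` with
`m + n = N`.  The operator `a†b − ab†` conserves the total photon number `m + n`, so it is the direct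
sum over `N` of these finite matrices. -/
def generator (N : ℕ) :
    Matrix (Finset.HasAntidiagonal.antidiagonal N) (Finset.HasAntidiagonal.antidiagonal N) ℂ :=
  Matrix.of fun x y =>
    creation x.1.1 y.1.1 * annihilation x.1.2 y.1.2
      - annihilation x.1.1 y.1.1 * creation x.1.2 y.1.2

/-- The restriction of `exp (θ (a†b − ab†))` to total photon number `N`. -/
def sectorExp (θ : ℝ) (N : ℕ) :
    Matrix (Finset.HasAntidiagonal.antidiagonal N) (Finset.HasAntidiagonal.antidiagonal N) ℂ :=
  NormedSpace.exp ((θ : ℂ) • generator N)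

lemma sectorExp_conjTranspose_mul_self (θ : ℝ) (N : ℕ) :
    (sectorExp θ N).conjTranspose * sectorExp θ N = 1 := by
  have hskew : ((θ : ℂ) • generator N).conjTranspose = -((θ : ℂ) • generator N) := by
    ext x y
    simp [generator, creation]
    ring
  have hu := (Matrix.isUnit_iff_isUnit_det _).1 (Matrix.isUnit_exp ((θ : ℂ) • generator N))
  rw [sectorExp, ← Matrix.exp_conjTranspose, hskew, Matrix.exp_neg]
  exact Matrix.nonsing_inv_mul _ hu

/-- The vector `exp (θ (a†b − ab†)) |q⟩` for a Fock vector `|q⟩` of total photon number `N`. -/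
def sectorVec (θ : ℝ) (N : ℕ) (q : Finset.HasAntidiagonal.antidiagonal N) : L2 (ℕ × ℕ) :=
  ∑ x : Finset.HasAntidiagonal.antidiagonal N, sectorExp θ N x q • ket x.1

/-- The vector `exp (θ (a†b − ab†)) |m⟩|n⟩`, where `q = (m, n)`. -/
def beamSplitterVec (θ : ℝ) (q : ℕ × ℕ) : L2 (ℕ × ℕ) :=
  sectorVec θ (q.1 + q.2) ⟨q, by simp⟩

lemma beamSplitterVec_eq (θ : ℝ) (N : ℕ) (q : Finset.HasAntidiagonal.antidiagonal N) :
    beamSplitterVec θ q.1 = sectorVec θ N q := by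
  obtain ⟨q, hq⟩ := q
  obtain rfl := Finset.HasAntidiagonal.mem_antidiagonal.1 hq
  rfl

lemma inner_sectorVec (θ : ℝ) (N : ℕ) (p q : Finset.HasAntidiagonal.antidiagonal N) :
    ⟪sectorVec θ N p, sectorVec θ N q⟫_ℂ = if p = q then 1 else 0 := by
  have h := congrFun (congrFun (sectorExp_conjTranspose_mul_self θ N) p) q
  rw [Matrix.one_apply, Matrix.mul_apply] at h
  rw [← h]
  simp only [sectorVec, sum_inner, inner_sum, inner_smul_left, inner_smul_right, inner_ket_ket,
    Subtype.coe_inj]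
  simp [Matrix.conjTranspose_apply, mul_comm]

lemma orthonormal_beamSplitterVec (θ : ℝ) : Orthonormal ℂ (beamSplitterVec θ) := by
  rw [orthonormal_iff_ite]
  intro p q
  by_cases hN : p.1 + p.2 = q.1 + q.2
  · have hp := beamSplitterVec_eq θ (q.1 + q.2) ⟨p, by simp [hN]⟩
    have hq := beamSplitterVec_eq θ (q.1 + q.2) ⟨q, by simp⟩
    simp only at hp hq
    rw [hp, hq, inner_sectorVec]
    simp
  · have hpq : p ≠ q := fun h => hN (by rw [h])
    rw [if_neg hpq, beamSplitterVec, beamSplitterVec, sectorVec, sectorVec]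
    simp only [sum_inner, inner_sum]
    refine Finset.sum_eq_zero fun x _ => Finset.sum_eq_zero fun y _ => ?_
    have hx := Finset.HasAntidiagonal.mem_antidiagonal.1 x.2
    have hy := Finset.HasAntidiagonal.mem_antidiagonal.1 y.2
    have : y.1 ≠ x.1 := fun h => hN (by rw [← hx, ← hy, h])
    rw [inner_smul_left, inner_smul_right, inner_ket_ket]
    simp [this]

/-- The beam splitter `U_λ = exp (arccos √λ · (a†b − ab†))` on the two modes `S E`. -/
def beamSplitter (lam : ℝ) : Op (ℕ × ℕ) (ℕ × ℕ) :=
  isometryOf (orthonormal_beamSplitterVec (Real.arccos √lam))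

/-- The pure-loss channel `ρ ↦ Tr_E [U_λ (ρ ⊗ |0⟩⟨0|) U_λ†]`; here `ρ ⊗ |0⟩⟨0|` is
`(1 ⊗ |0⟩) ρ (1 ⊗ ⟨0|)`. -/
def pureLoss (lam : ℝ) : traceClass ℕ →ₗ[ℂ] traceClass ℕ :=
  partialTraceRight ∘ₗ conj (beamSplitter lam) ∘ₗ conj (tensorKet (0 : ℕ))

end BeamSplitter

section Fading

variable {d : ℕ}

/-- The fading channel `∑ n, p n • E_{λ n}`. -/
def fading (p lam : Fin d → ℝ) : traceClass ℕ →ₗ[ℂ] traceClass ℕ :=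
  ∑ n, (p n : ℂ) • pureLoss (lam n)

/-- The isometry `1_{SE} ⊗ |n⟩_A` from `S E` to `S (E A)`. -/
def tensorAncilla (n : Fin d) : Op (ℕ × ℕ) (ℕ × (ℕ × Fin d)) :=
  embed ⟨fun q => (q.1, (q.2, n)), fun a b h => by
    simp only [Prod.mk.injEq] at h
    exact Prod.ext h.1 h.2.1⟩

/-- The controlled beam splitter `V = ∑ n, U_{λ n} ⊗ |n⟩⟨n|`. -/
def controlledBeamSplitter (lam : Fin d → ℝ) :
    Op (ℕ × (ℕ × Fin d)) (ℕ × (ℕ × Fin d)) :=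
  ∑ n, tensorAncilla n ∘L beamSplitter (lam n) ∘L (tensorAncilla n).adjoint

/-- The map `x ↦ x ⊗ |0⟩_E ⊗ |ψ_p⟩_A`, with `|ψ_p⟩ = ∑ n, √(p n) |n⟩`. -/
def prepare (p : Fin d → ℝ) : Op ℕ (ℕ × (ℕ × Fin d)) :=
  ∑ n, (√(p n) : ℂ) • (tensorAncilla n ∘L tensorKet (0 : ℕ))

/-- The complementary fading channel
`ρ ↦ Tr_S [V (ρ ⊗ |0⟩⟨0|_E ⊗ |ψ_p⟩⟨ψ_p|_A) V†]`. -/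
def complementary (p lam : Fin d → ℝ) : traceClass ℕ →ₗ[ℂ] traceClass (ℕ × Fin d) :=
  partialTraceLeft ∘ₗ conj (controlledBeamSplitter lam) ∘ₗ conj (prepare p)

/-- The fading channel is antidegradable: it is obtained from its complementary channel by
post-composition with a quantum channel. -/
def IsAntidegradable (p lam : Fin d → ℝ) : Prop :=
  ∃ A : traceClass (ℕ × Fin d) →ₗ[ℂ] traceClass ℕ,
    IsQuantumChannel A ∧ fading p lam = A ∘ₗ complementary p lam

end Fading

end

end FadingChannel

/-!
The one-photon component of `U_λ` is a plane rotation by `θ = arccos √λ`, so the vacuum is fixed and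
`U_λ |1⟩|0⟩ = √λ |1⟩|0⟩ - √(1 - λ) |0⟩|1⟩`.  Tracing out one side or the other gives

* `Φ(|0⟩⟨0|) = |0⟩⟨0|` and `Φ(|1⟩⟨1|) = ⟨λ⟩ |1⟩⟨1| + (1 - ⟨λ⟩) |0⟩⟨0|`;
* `Φ̃(|0⟩⟨0|) = |v⟩⟨v|` and `Φ̃(|1⟩⟨1|) = |a⟩⟨a| + |b⟩⟨b|`, where `v = ∑ √(p n) |0⟩|n⟩`,
  `a = ∑ √(p n λ n) |0⟩|n⟩` and `b = -∑ √(p n (1 - λ n)) |1⟩|n⟩` is orthogonal to `v`.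

In both pairs the first state is pure, so the fidelity is an expectation value
(`fidelity_ketBra`), which is `1 - ⟨λ⟩` for the first pair and `⟨v, a⟩² = ⟨√λ⟩²` for the second.

If `Φ = A ∘ Φ̃` for a channel `A`, then `A` cannot decrease the fidelity, whence `⟨√λ⟩² ≤ 1 - ⟨λ⟩`.
Here `A` maps `|v⟩⟨v|` to `|0⟩⟨0|`, and in this situation monotonicity has a short proof
(`IsQuantumChannel.sq_le_diagRe`): the quadratic form `x ↦ ⟨0|A(|x⟩⟨x|)|0⟩` lies between `0` and
`‖x‖²` and attains the upper bound at the unit vector `v`, so at `a` it is at least `⟨v, a⟩²`.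
For the erasure channel the condition reads `p ^ 2 + p > 1`.
-/

namespace FadingChannel

open scoped InnerProductSpace

/-! ### Operators determined by basis vectors -/

section Kets

variable {ι κ : Type*}

lemma ext_inner_ket {x y : L2 ι} (h : ∀ i, ⟪ket i, x⟫_ℂ = ⟪ket i, y⟫_ℂ) : x = y := by
  have h0 := hasSum_norm_sq (x - y)
  simp only [inner_sub_right, h, sub_self, norm_zero] at h0
  norm_num at h0
  have := h0.unique hasSum_zero
  simpa [sub_eq_zero] using this

lemma op_ext_ket {S T : Op ι κ} (h : ∀ i, S (ket i) = T (ket i)) : S = T := by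
  have hadj : S.adjoint = T.adjoint := by
    refine ContinuousLinearMap.ext fun y => ext_inner_ket fun i => ?_
    rw [ContinuousLinearMap.adjoint_inner_right, ContinuousLinearMap.adjoint_inner_right, h]
  exact (ContinuousLinearMap.adjoint (𝕜 := ℂ)).injective hadj

lemma norm_ket (i : ι) : ‖(ket i : L2 ι)‖ = 1 := orthonormal_ket.1 i

lemma adjoint_embed_embed_self (f : ι ↪ κ) (x : L2 ι) : (embed f).adjoint (embed f x) = x := by
  classical
  have : (embed f).adjoint ∘L embed f = ContinuousLinearMap.id ℂ (L2 ι) := by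
    refine op_ext_ket fun i => ext_inner_ket fun j => ?_
    simp [ContinuousLinearMap.adjoint_inner_right, embed_ket, inner_ket_ket]
  exact congrArg (fun T : Op ι ι => T x) this

lemma adjoint_embed_embed_of_disjoint {ι' : Type*} {f : ι ↪ κ} {g : ι' ↪ κ}
    (h : ∀ i j, f i ≠ g j) (x : L2 ι') : (embed f).adjoint (embed g x) = 0 := by
  classical
  have : (embed f).adjoint ∘L embed g = 0 := by
    refine op_ext_ket fun i => ext_inner_ket fun j => ?_
    simp [ContinuousLinearMap.adjoint_inner_right, embed_ket, inner_ket_ket, h]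
  exact congrArg (fun T : Op ι' ι => T x) this

lemma tensorKet_ket (k : κ) (i : ι) : tensorKet k (ket i) = (ket (i, k) : L2 (ι × κ)) :=
  embed_ket _ _

lemma adjoint_tensorKet_tensorKet_self (k : κ) (x : L2 ι) :
    (tensorKet k).adjoint (tensorKet k x) = x :=
  adjoint_embed_embed_self _ x

lemma adjoint_tensorKet_tensorKet_of_ne {k l : κ} (h : k ≠ l) (x : L2 ι) :
    (tensorKet k).adjoint (tensorKet l x) = 0 :=
  adjoint_embed_embed_of_disjoint (fun _ _ e => h (Prod.ext_iff.1 e).2) x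

end Kets

/-! ### Rank-one operators, partial traces and fidelity -/

section RankOne

variable {ι κ : Type*}

lemma inner_rankOne_ket (x : L2 ι) (i : ι) :
    ⟪ket i, InnerProductSpace.rankOne ℂ x x (ket i)⟫_ℂ = ((‖⟪ket i, x⟫_ℂ‖ ^ 2 : ℝ) : ℂ) := by
  rw [InnerProductSpace.rankOne_apply, inner_smul_right, ← inner_conj_symm x (ket i),
    RCLike.conj_mul]
  norm_cast

lemma hasSum_inner_rankOne_ket (x : L2 ι) :
    HasSum (fun i => ⟪ket i, InnerProductSpace.rankOne ℂ x x (ket i)⟫_ℂ) ((‖x‖ ^ 2 : ℝ) : ℂ) := by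
  simp only [inner_rankOne_ket]
  exact Complex.hasSum_ofReal.2 (hasSum_norm_sq x)

/-- The positive rank-one operator `|x⟩⟨x|`, for a vector `x` that need not be normalised. -/
noncomputable def ketBra (x : L2 ι) : traceClass ι :=
  ⟨InnerProductSpace.rankOne ℂ x x, Submodule.subset_span
    ⟨InnerProductSpace.isPositive_rankOne_self _, (hasSum_inner_rankOne_ket x).summable⟩⟩

lemma coe_ketBra (x : L2 ι) : (ketBra x : Op ι ι) = InnerProductSpace.rankOne ℂ x x := rfl

lemma pureKet_eq_ketBra (i : ι) : pureKet i = ketBra (ket i) := rfl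

lemma ketBra_zero : ketBra (0 : L2 ι) = 0 := by ext1; simp [coe_ketBra]

lemma ketBra_smul (c : ℂ) (x : L2 ι) : ketBra (c • x) = ((‖c‖ ^ 2 : ℝ) : ℂ) • ketBra x := by
  ext1
  refine ContinuousLinearMap.ext fun y => ?_
  simp only [coe_ketBra, Submodule.coe_smul, _root_.smul_apply,
    InnerProductSpace.rankOne_apply, inner_smul_left, smul_smul]
  congr 1
  rw [mul_right_comm, RCLike.conj_mul]
  norm_cast

/-- Polarisation along a real line: the cross terms of `|t v + a⟩⟨t v + a|` are those of
`|v + a⟩⟨v + a|`, scaled by `t`. -/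
lemma ketBra_real_smul_add (t : ℝ) (v a : L2 ι) :
    ketBra ((t : ℂ) • v + a) =
      ((t ^ 2 : ℝ) : ℂ) • ketBra v + (t : ℂ) • (ketBra (v + a) - ketBra v - ketBra a)
        + ketBra a := by
  ext1
  refine ContinuousLinearMap.ext fun y => ?_
  simp only [coe_ketBra, Submodule.coe_smul, Submodule.coe_add, Submodule.coe_sub,
    _root_.smul_apply, _root_.add_apply, _root_.sub_apply,
    InnerProductSpace.rankOne_apply, inner_smul_left, inner_add_left, Complex.conj_ofReal]
  push_cast
  module

lemma trace_ketBra (x : L2 ι) : trace (ketBra x : Op ι ι) = ((‖x‖ ^ 2 : ℝ) : ℂ) :=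
  (hasSum_inner_rankOne_ket x).tsum_eq

lemma conj_ketBra (W : Op ι κ) (x : L2 ι) : conj W (ketBra x) = ketBra (W x) := by
  ext1
  refine ContinuousLinearMap.ext fun y => ?_
  change W (InnerProductSpace.rankOne ℂ x x (W.adjoint y)) = InnerProductSpace.rankOne ℂ _ _ y
  rw [InnerProductSpace.rankOne_apply, InnerProductSpace.rankOne_apply, map_smul,
    ContinuousLinearMap.adjoint_inner_right]

lemma block_ketBra (k : κ) (z : L2 (ι × κ)) :
    block k (ketBra z : Op (ι × κ) (ι × κ)) = ketBra ((tensorKet k).adjoint z) := by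
  refine ContinuousLinearMap.ext fun y => ?_
  change (tensorKet k).adjoint (InnerProductSpace.rankOne ℂ z z (tensorKet k y))
    = InnerProductSpace.rankOne ℂ _ _ y
  rw [InnerProductSpace.rankOne_apply, InnerProductSpace.rankOne_apply, map_smul,
    ContinuousLinearMap.adjoint_inner_left]

lemma partialTraceRight_ketBra_add {k l : κ} (hkl : k ≠ l) (x y : L2 ι) :
    partialTraceRight (ketBra (tensorKet k x + tensorKet l y)) = ketBra x + ketBra y := by
  classical
  ext1
  change ∑' j, block j (ketBra (tensorKet k x + tensorKet l y) : Op (ι × κ) (ι × κ)) = _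
  simp only [block_ketBra, map_add]
  rw [tsum_eq_sum (s := {k, l}), Finset.sum_pair hkl]
  · simp [adjoint_tensorKet_tensorKet_self, adjoint_tensorKet_tensorKet_of_ne hkl,
      adjoint_tensorKet_tensorKet_of_ne hkl.symm]
  · intro j hj
    simp only [Finset.mem_insert, Finset.mem_singleton, not_or] at hj
    simp [adjoint_tensorKet_tensorKet_of_ne hj.1, adjoint_tensorKet_tensorKet_of_ne hj.2,
      ketBra_zero]

lemma sqrt_ketBra {v : L2 ι} (hv : ‖v‖ = 1) : CFC.sqrt (ketBra v : Op ι ι) = ketBra v :=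
  CFC.sqrt_unique (InnerProductSpace.isIdempotentElem_rankOne_self hv)
    ((ContinuousLinearMap.nonneg_iff_isPositive _).2 (InnerProductSpace.isPositive_rankOne_self v))

/-- The fidelity with a pure state `|v⟩⟨v|` is the expectation value `⟨v|σ|v⟩`. -/
lemma fidelity_ketBra {v : L2 ι} (hv : ‖v‖ = 1) {σ : traceClass ι} {c : ℝ} (hc : 0 ≤ c)
    (h : ⟪v, (σ : Op ι ι) v⟫_ℂ = c) : fidelity (ketBra v) σ = c := by
  have hvv : ⟪v, v⟫_ℂ = 1 := by simp [inner_self_eq_norm_sq_to_K, hv]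
  have h4 : (c ^ (1 / 4 : ℝ)) ^ 4 = c := by
    rw [← Real.rpow_natCast, ← Real.rpow_mul hc]; norm_num
  have hP : (ketBra v : Op ι ι) * (σ : Op ι ι) * (ketBra v : Op ι ι)
      = (c : ℂ) • (ketBra v : Op ι ι) := by
    refine ContinuousLinearMap.ext fun y => ?_
    simp only [coe_ketBra, mul_apply_eq_comp, _root_.smul_apply,
      InnerProductSpace.rankOne_apply, map_smul, h, smul_smul]
    rw [mul_comm]
  -- The root `√c |v⟩⟨v|` is `|x⟩⟨x|` for `x = c ^ (1 / 4) v`, hence positive.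
  have hsqrt : CFC.sqrt ((c : ℂ) • (ketBra v : Op ι ι))
      = ketBra (((c ^ (1 / 4 : ℝ) : ℝ) : ℂ) • v) := by
    refine CFC.sqrt_unique ?_ ((ContinuousLinearMap.nonneg_iff_isPositive _).2
      (InnerProductSpace.isPositive_rankOne_self _))
    rw [ketBra_smul, Submodule.coe_smul, smul_mul_smul_comm]
    congr 1
    · rw [← Complex.ofReal_mul, Complex.norm_real, Real.norm_eq_abs, sq_abs, ← sq, ← pow_mul, h4]
    · exact InnerProductSpace.isIdempotentElem_rankOne_self hv
  rw [fidelity, sqrt_ketBra hv, hP, hsqrt, trace_ketBra, Complex.ofReal_re, norm_smul, hv, mul_one,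
    Complex.norm_real, Real.norm_eq_abs, sq_abs, ← pow_mul, h4]

end RankOne

/-! ### Monotonicity of the fidelity for a pure input -/

section DataProcessing

variable {ι κ : Type*}

lemma summable_inner_ket (T : traceClass ι) :
    Summable fun i => ⟪ket i, (T : Op ι ι) (ket i)⟫_ℂ := by
  obtain ⟨T, hT⟩ := T
  change Summable fun i => ⟪ket i, T (ket i)⟫_ℂ
  induction hT using Submodule.span_induction with
  | mem T hT => exact hT.2
  | zero => simp
  | add S T _ _ hS hT => simpa [inner_add_right] using hS.add hT
  | smul c T _ hT => simpa [inner_smul_right] using hT.mul_left c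

/-- The real part `re ⟨i|T|i⟩` of a diagonal matrix entry, a real-linear functional. -/
noncomputable def diagRe (i : ι) (T : traceClass ι) : ℝ := (⟪ket i, (T : Op ι ι) (ket i)⟫_ℂ).re

lemma diagRe_add (i : ι) (S T : traceClass ι) : diagRe i (S + T) = diagRe i S + diagRe i T := by
  simp [diagRe]

lemma diagRe_sub (i : ι) (S T : traceClass ι) : diagRe i (S - T) = diagRe i S - diagRe i T := by
  simp [diagRe]

lemma diagRe_real_smul (i : ι) (t : ℝ) (T : traceClass ι) :
    diagRe i ((t : ℂ) • T) = t * diagRe i T := by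
  simp [diagRe]

open ComplexOrder in
lemma IsQuantumChannel.inner_nonneg {A : traceClass ι →ₗ[ℂ] traceClass κ} (hA : IsQuantumChannel A)
    (x : L2 ι) (y : L2 κ) : 0 ≤ ⟪y, (A (ketBra x) : Op κ κ) y⟫_ℂ := by
  have h := hA.completelyPositive 1 (fun _ _ => ketBra x) (fun z => by
    have h0 := (InnerProductSpace.isPositive_rankOne_self (𝕜 := ℂ) x).inner_nonneg_right (z 0)
    rw [← coe_ketBra] at h0
    simpa using h0) (fun _ => y)
  simpa using h

lemma IsQuantumChannel.diagRe_nonneg {A : traceClass ι →ₗ[ℂ] traceClass κ} (hA : IsQuantumChannel A)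
    (x : L2 ι) (j : κ) : 0 ≤ diagRe j (A (ketBra x)) :=
  (Complex.nonneg_iff.1 (hA.inner_nonneg x (ket j))).1

lemma IsQuantumChannel.diagRe_le {A : traceClass ι →ₗ[ℂ] traceClass κ} (hA : IsQuantumChannel A)
    (x : L2 ι) (j : κ) : diagRe j (A (ketBra x)) ≤ ‖x‖ ^ 2 := by
  have h := hA.tracePreserving (ketBra x)
  rw [trace_ketBra] at h
  have hs : HasSum (fun i => ⟪ket i, (A (ketBra x) : Op κ κ) (ket i)⟫_ℂ) ((‖x‖ ^ 2 : ℝ) : ℂ) :=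
    h ▸ (summable_inner_ket (A (ketBra x))).hasSum
  exact le_hasSum (Complex.hasSum_re hs) j fun i _ => hA.diagRe_nonneg x i

/-- The instance of monotonicity of the fidelity under channels in which one of the input states is
a pure state `|v⟩⟨v|` mapped to `|j⟩⟨j|`.  The quadratic form `g x = ⟨j|A(|x⟩⟨x|)|j⟩` satisfies
`0 ≤ g x ≤ ‖x‖²`, with equality on the right at `v`; hence every vector orthogonal to `v` is also
orthogonal to `v` for the form `g`, and `g a` is at least the value of `g` at the component of `a`
along `v`. -/
lemma IsQuantumChannel.sq_le_diagRe {A : traceClass ι →ₗ[ℂ] traceClass κ} (hA : IsQuantumChannel A)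
    {v a : L2 ι} (hv : ‖v‖ = 1) {γ : ℝ} (hγ : ⟪v, a⟫_ℂ = γ) {j : κ}
    (hvj : A (ketBra v) = pureKet j) : γ ^ 2 ≤ diagRe j (A (ketBra a)) := by
  have hgv : diagRe j (A (ketBra v)) = 1 := by
    rw [hvj, diagRe]
    change (⟪ket j, InnerProductSpace.rankOne ℂ (ket j) (ket j) (ket j)⟫_ℂ).re = 1
    rw [inner_rankOne_ket]
    simp [inner_self_eq_norm_sq_to_K, norm_ket]
  set h := diagRe j (A (ketBra (v + a))) - 1 - diagRe j (A (ketBra a)) with hh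
  have hg : ∀ t : ℝ, diagRe j (A (ketBra ((t : ℂ) • v + a)))
      = t ^ 2 + t * h + diagRe j (A (ketBra a)) := by
    intro t
    rw [ketBra_real_smul_add, map_add, map_add, map_smul, map_smul, map_sub, map_sub, diagRe_add,
      diagRe_add, diagRe_real_smul, diagRe_real_smul, diagRe_sub, diagRe_sub, hgv, mul_one]
  have hnorm : ∀ t : ℝ, ‖(t : ℂ) • v + a‖ ^ 2 = t ^ 2 + 2 * t * γ + ‖a‖ ^ 2 := by
    intro t
    rw [@norm_add_sq ℂ, inner_smul_left, hγ, norm_smul, hv]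
    simp
    ring
  have hle : ∀ t : ℝ, t * (h - 2 * γ) ≤ ‖a‖ ^ 2 - diagRe j (A (ketBra a)) := by
    intro t
    have := hA.diagRe_le ((t : ℂ) • v + a) j
    rw [hg, hnorm] at this
    linarith
  -- The left side of `hle` is linear in `t` and bounded above, so the cross terms agree.
  have hγ2 : h = 2 * γ := by
    by_contra hne
    have hd : h - 2 * γ ≠ 0 := sub_ne_zero.2 hne
    have := hle ((‖a‖ ^ 2 - diagRe j (A (ketBra a)) + 1) / (h - 2 * γ))
    rw [div_mul_cancel₀ _ hd] at this
    linarith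
  -- Evaluate the form at `a - γ v`, the component of `a` orthogonal to `v`.
  have := hA.diagRe_nonneg (((-γ : ℝ) : ℂ) • v + a) j
  rw [hg, hγ2] at this
  nlinarith

end DataProcessing

/-! ### The beam splitter on at most one photon -/

section BeamSplitter

lemma sectorExp_zero (θ : ℝ) : sectorExp θ 0 = 1 := by
  have : generator 0 = 0 := by
    ext ⟨x, hx⟩ ⟨y, hy⟩
    obtain rfl : x = (0, 0) := by simpa using hx
    obtain rfl : y = (0, 0) := by simpa using hy
    change creation 0 0 * annihilation 0 0 - annihilation 0 0 * creation 0 0 = 0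
    ring
  rw [sectorExp, this, smul_zero, NormedSpace.exp_zero]

lemma beamSplitter_ket_zero (lam : ℝ) : beamSplitter lam (ket (0, 0)) = ket (0, 0) := by
  rw [beamSplitter, isometryOf_ket, beamSplitterVec]
  change sectorVec _ 0 ⟨(0, 0), _⟩ = _
  simp only [sectorVec, sectorExp_zero, Matrix.one_apply, ite_smul, one_smul, zero_smul,
    Finset.sum_ite_eq', Finset.mem_univ, if_true]

/-- The one-photon Fock vector `|1⟩|0⟩`, as an index of the one-photon sector. -/
def signalIndex : Finset.HasAntidiagonal.antidiagonal 1 := ⟨(1, 0), by simp⟩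

/-- The one-photon Fock vector `|0⟩|1⟩`, as an index of the one-photon sector. -/
def environmentIndex : Finset.HasAntidiagonal.antidiagonal 1 := ⟨(0, 1), by simp⟩

lemma signalIndex_ne_environmentIndex : signalIndex ≠ environmentIndex := by
  simp [signalIndex, environmentIndex]

lemma eq_signalIndex_or_eq_environmentIndex (x : Finset.HasAntidiagonal.antidiagonal 1) :
    x = signalIndex ∨ x = environmentIndex := by
  obtain ⟨⟨m, n⟩, hx⟩ := x
  have := Finset.HasAntidiagonal.mem_antidiagonal.1 hx
  simp only [signalIndex, environmentIndex, Subtype.mk.injEq, Prod.mk.injEq]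
  simp only at this
  omega

lemma sum_onePhoton {M : Type*} [AddCommMonoid M] (f : Finset.HasAntidiagonal.antidiagonal 1 → M) :
    ∑ x, f x = f signalIndex + f environmentIndex :=
  Fintype.sum_eq_add _ _ signalIndex_ne_environmentIndex fun x hx =>
    ((eq_signalIndex_or_eq_environmentIndex x).elim hx.1 hx.2).elim

lemma generator_one_mul_self : generator 1 * generator 1 = -1 := by
  ext x y
  rw [Matrix.mul_apply, sum_onePhoton]
  rcases eq_signalIndex_or_eq_environmentIndex x with rfl | rfl <;>
    rcases eq_signalIndex_or_eq_environmentIndex y with rfl | rfl <;>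
    simp [generator, creation, annihilation, signalIndex, environmentIndex]

/-- The generator squares to `-1` in the one-photon sector, so `i ↦ generator 1` extends to an
algebra map from `ℂ`, which transports Euler's formula. -/
lemma sectorExp_one (θ : ℝ) :
    sectorExp θ 1 = (Real.cos θ : ℂ) • 1 + (Real.sin θ : ℂ) • generator 1 := by
  let f := Complex.liftAux (generator 1) generator_one_mul_self
  have hf : Continuous f := f.toLinearMap.continuous_of_finiteDimensional
  have h : f (NormedSpace.exp ((θ : ℂ) * Complex.I))
      = NormedSpace.exp (f ((θ : ℂ) * Complex.I)) := by
    -- `NormedSpace.map_exp` asks for a norm on matrices, which does not enter its conclusion.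
    let := Matrix.linftyOpNormedRing (n := Finset.HasAntidiagonal.antidiagonal 1) (α := ℂ)
    exact NormedSpace.map_exp f hf _
  have h1 : f ((θ : ℂ) * Complex.I) = (θ : ℂ) • generator 1 := by
    simp [f, Complex.liftAux_apply]
  rw [h1] at h
  rw [sectorExp, ← h, ← Complex.exp_eq_exp_ℂ, Complex.liftAux_apply,
    Complex.exp_ofReal_mul_I_re, Complex.exp_ofReal_mul_I_im]
  ext x y
  simp [Matrix.algebraMap_matrix_apply, Matrix.one_apply]

lemma beamSplitter_ket_one {lam : ℝ} (h : lam ∈ Set.Icc (0 : ℝ) 1) :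
    beamSplitter lam (ket (1, 0))
      = (√lam : ℂ) • ket (1, 0) + ((-√(1 - lam) : ℝ) : ℂ) • ket (0, 1) := by
  have hcos : Real.cos (Real.arccos √lam) = √lam :=
    Real.cos_arccos (by linarith [Real.sqrt_nonneg lam]) (Real.sqrt_le_one.2 h.2)
  have hsin : Real.sin (Real.arccos √lam) = √(1 - lam) := by
    rw [Real.sin_arccos, Real.sq_sqrt h.1]
  rw [beamSplitter, isometryOf_ket]
  change sectorVec _ 1 signalIndex = _
  rw [sectorVec, sum_onePhoton, sectorExp_one, hcos, hsin]
  simp [generator, creation, annihilation, signalIndex, environmentIndex]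

end BeamSplitter

/-! ### Channel outputs for zero and one photon -/

section Outputs

lemma pureLoss_ket_zero (lam : ℝ) : pureLoss lam (pureKet 0) = ketBra (ket 0) := by
  change partialTraceRight (conj _ (conj _ (pureKet 0))) = _
  rw [pureKet_eq_ketBra, conj_ketBra, conj_ketBra, tensorKet_ket, beamSplitter_ket_zero]
  have h := partialTraceRight_ketBra_add zero_ne_one (ket (0 : ℕ)) (0 : L2 ℕ) (k := 0) (l := 1)
  rwa [map_zero, add_zero, ketBra_zero, add_zero, tensorKet_ket] at h

lemma pureLoss_ket_one {lam : ℝ} (h : lam ∈ Set.Icc (0 : ℝ) 1) :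
    pureLoss lam (pureKet 1)
      = (lam : ℂ) • ketBra (ket 1) + ((1 - lam : ℝ) : ℂ) • ketBra (ket 0) := by
  change partialTraceRight (conj _ (conj _ (pureKet 1))) = _
  rw [pureKet_eq_ketBra, conj_ketBra, conj_ketBra, tensorKet_ket, beamSplitter_ket_one h,
    ← tensorKet_ket, ← tensorKet_ket, ← map_smul, ← map_smul,
    partialTraceRight_ketBra_add zero_ne_one, ketBra_smul, ketBra_smul]
  simp only [Complex.norm_real, Real.norm_eq_abs, sq_abs, neg_sq, Real.sq_sqrt h.1,
    Real.sq_sqrt (sub_nonneg.2 h.2)]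

variable {d : ℕ} {p lam : Fin d → ℝ}

lemma fading_ket_zero (hp : ∑ n, p n = 1) : fading p lam (pureKet 0) = ketBra (ket 0) := by
  simp only [fading, LinearMap.sum_apply, LinearMap.smul_apply, pureLoss_ket_zero,
    ← Finset.sum_smul, ← Complex.ofReal_sum, hp, Complex.ofReal_one, one_smul]

lemma fading_ket_one (hp : ∑ n, p n = 1) (hlam : ∀ n, lam n ∈ Set.Icc (0 : ℝ) 1) :
    fading p lam (pureKet 1) = ((∑ n, p n * lam n : ℝ) : ℂ) • ketBra (ket 1)
      + ((1 - ∑ n, p n * lam n : ℝ) : ℂ) • ketBra (ket 0) := by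
  have h1 : 1 - ∑ n, p n * lam n = ∑ n, p n * (1 - lam n) := by
    simp [mul_sub, Finset.sum_sub_distrib, hp]
  rw [h1, Complex.ofReal_sum, Complex.ofReal_sum, Finset.sum_smul, Finset.sum_smul,
    ← Finset.sum_add_distrib, fading, LinearMap.sum_apply]
  refine Finset.sum_congr rfl fun n _ => ?_
  rw [LinearMap.smul_apply, pureLoss_ket_one (hlam n), smul_add, smul_smul, smul_smul,
    Complex.ofReal_mul, Complex.ofReal_mul]

lemma inner_fading_ket_one (hp : ∑ n, p n = 1) (hlam : ∀ n, lam n ∈ Set.Icc (0 : ℝ) 1) :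
    ⟪ket 0, (fading p lam (pureKet 1) : Op ℕ ℕ) (ket 0)⟫_ℂ = (1 - ∑ n, p n * lam n : ℝ) := by
  rw [fading_ket_one hp hlam]
  simp [coe_ketBra, inner_ket_ket, norm_ket]

lemma tensorAncilla_ket (n : Fin d) (q : ℕ × ℕ) :
    tensorAncilla n (ket q) = ket (q.1, (q.2, n)) :=
  embed_ket _ _

lemma controlledBeamSplitter_tensorAncilla (lam : Fin d → ℝ) (n : Fin d) (x : L2 (ℕ × ℕ)) :
    controlledBeamSplitter lam (tensorAncilla n x) = tensorAncilla n (beamSplitter (lam n) x) := by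
  rw [controlledBeamSplitter, sum_apply,
    Finset.sum_eq_single n]
  · rw [ContinuousLinearMap.comp_apply, ContinuousLinearMap.comp_apply]
    congr 2
    exact adjoint_embed_embed_self _ x
  · intro m _ hm
    rw [ContinuousLinearMap.comp_apply, ContinuousLinearMap.comp_apply]
    have h : (tensorAncilla m).adjoint (tensorAncilla n x) = 0 :=
      adjoint_embed_embed_of_disjoint
        (fun _ _ e => hm (Prod.ext_iff.1 (Prod.ext_iff.1 e).2).2) x
    rw [h, map_zero, map_zero]
  · simp

lemma controlledBeamSplitter_prepare (p lam : Fin d → ℝ) (m : ℕ) :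
    controlledBeamSplitter lam (prepare p (ket m))
      = ∑ n, (√(p n) : ℂ) • tensorAncilla n (beamSplitter (lam n) (ket (m, 0))) := by
  simp only [prepare, sum_apply, _root_.smul_apply,
    ContinuousLinearMap.comp_apply, map_sum, map_smul, tensorKet_ket,
    controlledBeamSplitter_tensorAncilla]

/-- The vector `∑ n, c n |m⟩|n⟩` of the environment and the ancilla. -/
noncomputable def ancillaVec (m : ℕ) (c : Fin d → ℝ) : L2 (ℕ × Fin d) :=
  ∑ n, (c n : ℂ) • ket (m, n)

lemma inner_ancillaVec (m : ℕ) (b c : Fin d → ℝ) :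
    ⟪ancillaVec m b, ancillaVec m c⟫_ℂ = ((∑ n, b n * c n : ℝ) : ℂ) := by
  simp [ancillaVec, inner_ket_ket, mul_comm]

lemma inner_ancillaVec_of_ne {m m' : ℕ} (h : m ≠ m') (b c : Fin d → ℝ) :
    ⟪ancillaVec m b, ancillaVec m' c⟫_ℂ = 0 := by
  simp [ancillaVec, inner_ket_ket, h]

lemma norm_ancillaVec_sqrt (h0 : ∀ n, 0 ≤ p n) (hp : ∑ n, p n = 1) :
    ‖ancillaVec 0 fun n => √(p n)‖ = 1 := by
  have h := inner_ancillaVec 0 (fun n => √(p n)) fun n => √(p n)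
  simp only [Real.mul_self_sqrt (h0 _), hp, inner_self_eq_norm_sq_to_K] at h
  have h' : ((‖ancillaVec 0 fun n => √(p n)‖ ^ 2 : ℝ) : ℂ) = 1 := by simpa using h
  rwa [Complex.ofReal_eq_one, pow_eq_one_iff_of_nonneg (norm_nonneg _) two_ne_zero] at h'

lemma partialTraceLeft_ketBra (z : L2 (ℕ × (ℕ × Fin d))) :
    partialTraceLeft (ketBra z)
      = partialTraceRight (ketBra (embed (Equiv.prodComm ℕ (ℕ × Fin d)).toEmbedding z)) := by
  rw [← conj_ketBra]
  rfl

lemma embed_prodComm_ket (q : ℕ × (ℕ × Fin d)) :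
    embed (Equiv.prodComm ℕ (ℕ × Fin d)).toEmbedding (ket q) = tensorKet q.1 (ket q.2) := by
  rw [embed_ket, tensorKet_ket]
  rfl

lemma complementary_ket_zero (p lam : Fin d → ℝ) :
    complementary p lam (pureKet 0) = ketBra (ancillaVec 0 fun n => √(p n)) := by
  change partialTraceLeft (conj _ (conj _ (pureKet 0))) = _
  have h := partialTraceRight_ketBra_add zero_ne_one (ancillaVec 0 fun n => √(p n)) 0
    (k := (0 : ℕ)) (l := 1)
  rw [map_zero, add_zero, ketBra_zero, add_zero] at h
  rw [pureKet_eq_ketBra, conj_ketBra, conj_ketBra, controlledBeamSplitter_prepare,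
    partialTraceLeft_ketBra, ← h]
  simp only [beamSplitter_ket_zero, tensorAncilla_ket, map_sum, map_smul, embed_prodComm_ket,
    ancillaVec]

lemma complementary_ket_one (p : Fin d → ℝ) (hlam : ∀ n, lam n ∈ Set.Icc (0 : ℝ) 1) :
    complementary p lam (pureKet 1) = ketBra (ancillaVec 0 fun n => √(p n) * √(lam n))
      + ketBra (ancillaVec 1 fun n => √(p n) * -√(1 - lam n)) := by
  change partialTraceLeft (conj _ (conj _ (pureKet 1))) = _
  rw [pureKet_eq_ketBra, conj_ketBra, conj_ketBra, controlledBeamSplitter_prepare,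
    partialTraceLeft_ketBra, ← partialTraceRight_ketBra_add (one_ne_zero (α := ℕ))]
  simp only [beamSplitter_ket_one (hlam _), tensorAncilla_ket, map_sum, map_add, map_smul,
    embed_prodComm_ket, ancillaVec, smul_add, Finset.sum_add_distrib, smul_smul, Complex.ofReal_mul]

lemma inner_ancillaVec_sqrt (h0 : ∀ n, 0 ≤ p n) :
    ⟪ancillaVec 0 fun n => √(p n), ancillaVec 0 fun n => √(p n) * √(lam n)⟫_ℂ
      = ((∑ n, p n * √(lam n) : ℝ) : ℂ) := by
  rw [inner_ancillaVec]
  simp only [← mul_assoc, Real.mul_self_sqrt (h0 _)]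

end Outputs

/-! ### Fidelities and antidegradability -/

section Antidegradability

variable {d : ℕ} {p lam : Fin d → ℝ}

lemma fidelity_fading (h0 : ∀ n, 0 ≤ p n) (hp : ∑ n, p n = 1)
    (hlam : ∀ n, lam n ∈ Set.Icc (0 : ℝ) 1) :
    fidelity (fading p lam (pureKet 0)) (fading p lam (pureKet 1)) = 1 - ∑ n, p n * lam n := by
  rw [fading_ket_zero hp]
  refine fidelity_ketBra (norm_ket 0) ?_ (inner_fading_ket_one hp hlam)
  rw [sub_nonneg, ← hp]
  exact Finset.sum_le_sum fun n _ => mul_le_of_le_one_right (h0 n) (hlam n).2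

lemma fidelity_complementary (h0 : ∀ n, 0 ≤ p n) (hp : ∑ n, p n = 1)
    (hlam : ∀ n, lam n ∈ Set.Icc (0 : ℝ) 1) :
    fidelity (complementary p lam (pureKet 0)) (complementary p lam (pureKet 1))
      = (∑ n, p n * √(lam n)) ^ 2 := by
  rw [complementary_ket_zero]
  refine fidelity_ketBra (norm_ancillaVec_sqrt h0 hp) (sq_nonneg _) ?_
  rw [complementary_ket_one p hlam, Submodule.coe_add, _root_.add_apply, inner_add_right,
    coe_ketBra, coe_ketBra, InnerProductSpace.rankOne_apply, InnerProductSpace.rankOne_apply, inner_smul_right,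
    inner_smul_right, inner_ancillaVec_of_ne zero_ne_one, mul_zero, add_zero, ← inner_conj_symm,
    inner_ancillaVec_sqrt h0, Complex.conj_ofReal]
  push_cast
  ring

/-- If `A` degrades the complementary channel, it sends the complementary vacuum output, a pure
state, to `|0⟩⟨0|`.  Monotonicity of the fidelity then bounds from below the vacuum population of
the one-photon output, which is `1 - ⟨λ⟩`. -/
lemma IsAntidegradable.sq_sum_add_sum_le (h0 : ∀ n, 0 ≤ p n) (hp : ∑ n, p n = 1)
    (hlam : ∀ n, lam n ∈ Set.Icc (0 : ℝ) 1) (h : IsAntidegradable p lam) :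
    (∑ n, p n * √(lam n)) ^ 2 + ∑ n, p n * lam n ≤ 1 := by
  obtain ⟨A, hA, hAc⟩ := h
  have hzero : A (ketBra (ancillaVec 0 fun n => √(p n))) = pureKet 0 := by
    rw [← complementary_ket_zero p lam, ← LinearMap.comp_apply, ← hAc, fading_ket_zero hp,
      pureKet_eq_ketBra]
  have hone : diagRe 0 (A (complementary p lam (pureKet 1))) = 1 - ∑ n, p n * lam n := by
    rw [← LinearMap.comp_apply, ← hAc, diagRe, inner_fading_ket_one hp hlam, Complex.ofReal_re]
  rw [complementary_ket_one p hlam, map_add, diagRe_add] at hone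
  have h1 := hA.sq_le_diagRe (norm_ancillaVec_sqrt h0 hp) (inner_ancillaVec_sqrt h0) hzero
    (a := ancillaVec 0 fun n => √(p n) * √(lam n))
  have h2 := hA.diagRe_nonneg (ancillaVec 1 fun n => √(p n) * -√(1 - lam n)) 0
  linarith

end Antidegradability

lemma erasure_condition_iff {p : ℝ} (hp : p ∈ Set.Icc (0 : ℝ) 1) :
    ((∑ n, ![p, 1 - p] n * √(![1, 0] n)) ^ 2 + ∑ n, ![p, 1 - p] n * ![1, 0] n > 1) ↔
      p > (√5 - 1) / 2 := by
  simp only [Fin.sum_univ_two, Matrix.cons_val_zero, Matrix.cons_val_one, Real.sqrt_one,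
    Real.sqrt_zero, mul_one, mul_zero, add_zero, gt_iff_lt]
  have h5 : √5 ^ 2 = 5 := Real.sq_sqrt (by norm_num)
  -- With `q = (√5 - 1) / 2`, `p ^ 2 + p - 1 = (p - q) * (p + q + 1)` and `p + q + 1 > 0`.
  have hfac : p ^ 2 + p - 1 = (p - (√5 - 1) / 2) * (p + (√5 + 1) / 2) := by
    linear_combination h5 / 4
  have hpos : 0 < p + (√5 + 1) / 2 := by linarith [hp.1, Real.sqrt_nonneg 5]
  rw [← sub_pos, hfac, mul_pos_iff_of_pos_right hpos, sub_pos]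

end FadingChannel
open FadingChannel in
theorem mainTheorem4 :
    (∀ (d : ℕ) (p lam : Fin d → ℝ), (∀ n, 0 ≤ p n) → ∑ n, p n = 1 →
      (∀ n, lam n ∈ Set.Icc (0 : ℝ) 1) →
        fidelity (fading p lam (pureKet 0)) (fading p lam (pureKet 1)) = 1 - ∑ n, p n * lam n ∧
        fidelity (complementary p lam (pureKet 0)) (complementary p lam (pureKet 1))
          = (∑ n, p n * √(lam n)) ^ 2 ∧
        ((∑ n, p n * √(lam n)) ^ 2 + ∑ n, p n * lam n > 1 → ¬ IsAntidegradable p lam)) ∧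
    (∀ p : ℝ, p ∈ Set.Icc (0 : ℝ) 1 →
      (((∑ n, ![p, 1 - p] n * √(![1, 0] n)) ^ 2 + ∑ n, ![p, 1 - p] n * ![1, 0] n > 1) ↔
        p > (√5 - 1) / 2) ∧
      (p > (√5 - 1) / 2 → ¬ IsAntidegradable ![p, 1 - p] ![1, 0])) := by
  refine ⟨fun d p lam h0 hp hlam => ⟨fidelity_fading h0 hp hlam, fidelity_complementary h0 hp hlam,
    fun h hanti => h.not_ge (hanti.sq_sum_add_sum_le h0 hp hlam)⟩,
    fun p hp => ⟨erasure_condition_iff hp, fun h hanti => ?_⟩⟩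
  refine ((erasure_condition_iff hp).2 h).not_ge (hanti.sq_sum_add_sum_le ?_ ?_ ?_)
  · simpa [Fin.forall_fin_two] using hp
  · simp
  · simp [Fin.forall_fin_two]
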